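/- Call a vector $t\in\mathbf{R}^n$ \emph{positive} if all its coordinates are $\ge 0$ and at least one of them is $>0$. Let $k$ and $n$ be positive integers with $k\le n$, let $G(n,k)$ be the Grassmannian of $k$-dimensional linear subspaces of $\mathbf{R}^n$, and give it the Haar probability measure, that is, the image of the Haar probability measure on the orthogonal group $O(n)$ under the natural projection $O(n)\to G(n,k)$, $g\mapsto g(\mathrm{span}(e_1,\dots,e_k))$. Then the set of subspaces $V\in G(n,k)$ that contain a positive vector is a Borel set, and its measure $p(n,k)$, the probability that a random $k$-dimensional subspace of $\mathbf{R}^n$ contains a positive vector, is \[ p(n,k)=\frac{1}{2^{n-1}}\sum_{j=0}^{k-1}\binom{n-1}{j}. \] -/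

import Mathlib

open MeasureTheory TopologicalSpace

/-- A vector of `ℝⁿ` is positive if all its coordinates are nonnegative and at least one of them
is positive. -/
def IsPositiveVector {n : ℕ} (t : EuclideanSpace ℝ (Fin n)) : Prop :=
  (∀ i, 0 ≤ t i) ∧ ∃ i, 0 < t i

/-- The Grassmannian `G(n, k)`: the set of all `k`-dimensional linear subspaces of `ℝⁿ`. -/
def RealGrassmannian (n k : ℕ) : Type :=
  {V : Submodule ℝ (EuclideanSpace ℝ (Fin n)) // Module.finrank ℝ V = k}

/-- The usual topology of `G(n, k)`, which is that of the orthogonal projections onto the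
subspaces, in the space of linear operators on `ℝⁿ`. -/
noncomputable instance RealGrassmannian.instTopologicalSpace (n k : ℕ) :
    TopologicalSpace (RealGrassmannian n k) :=
  TopologicalSpace.induced
    (fun V : RealGrassmannian n k => (V.1.starProjection :
      EuclideanSpace ℝ (Fin n) →L[ℝ] EuclideanSpace ℝ (Fin n)))
    inferInstance

noncomputable instance RealGrassmannian.instMeasurableSpace (n k : ℕ) :
    MeasurableSpace (RealGrassmannian n k) := borel _

instance RealGrassmannian.instBorelSpace (n k : ℕ) :
    BorelSpace (RealGrassmannian n k) := ⟨rfl⟩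

instance instMeasurableSpaceOrthogonalGroup (n : ℕ) :
    MeasurableSpace (Matrix.orthogonalGroup (Fin n) ℝ) := borel _

instance instBorelSpaceOrthogonalGroup (n : ℕ) :
    BorelSpace (Matrix.orthogonalGroup (Fin n) ℝ) := ⟨rfl⟩

instance instCompactSpaceOrthogonalGroup (n : ℕ) :
    CompactSpace (Matrix.orthogonalGroup (Fin n) ℝ) := by
  refine (isCompact_iff_compactSpace (s := ((Matrix.orthogonalGroup (Fin n) ℝ :
    Submonoid (Matrix (Fin n) (Fin n) ℝ)) : Set (Matrix (Fin n) (Fin n) ℝ)))).mp ?_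
  have hbox : IsCompact (Set.univ.pi fun _ : Fin n => Set.univ.pi fun _ : Fin n =>
      Set.Icc (-1 : ℝ) 1) :=
    isCompact_univ_pi fun _ => isCompact_univ_pi fun _ => isCompact_Icc
  have hclosed : IsClosed {A : Matrix (Fin n) (Fin n) ℝ | A * star A = 1} :=
    isClosed_eq (by fun_prop) continuous_const
  refine IsCompact.of_isClosed_subset (s := {A : Matrix (Fin n) (Fin n) ℝ |
    ∀ i j, A i j ∈ Set.Icc (-1 : ℝ) 1}) ?_ ?_ ?_
  · have : {A : Matrix (Fin n) (Fin n) ℝ | ∀ i j, A i j ∈ Set.Icc (-1 : ℝ) 1} =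
        (Set.univ.pi fun _ : Fin n => Set.univ.pi fun _ : Fin n => Set.Icc (-1 : ℝ) 1) := by
      ext A
      exact ⟨fun hA i _ j _ => hA i j, fun hA i j => hA i trivial j trivial⟩
    rw [this]
    exact hbox
  · have : ((Matrix.orthogonalGroup (Fin n) ℝ : Submonoid (Matrix (Fin n) (Fin n) ℝ)) :
        Set (Matrix (Fin n) (Fin n) ℝ)) = {A | A * star A = 1} := by
      ext A
      exact Matrix.mem_unitaryGroup_iff
    exact this ▸ hclosed
  · intro A hA i j
    have := entry_norm_bound_of_unitary (𝕜 := ℝ) hA i j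
    rw [Real.norm_eq_abs, abs_le] at this
    exact this

/-- Haar measure on the orthogonal group `O(n)`, of total mass `1`. -/
noncomputable def orthogonalHaar (n : ℕ) : Measure (Matrix.orthogonalGroup (Fin n) ℝ) :=
  Measure.haarMeasure ⊤

/-- The linear isometry of `ℝⁿ` given by an orthogonal matrix. -/
noncomputable def orthogonalIsometry {n : ℕ} (g : Matrix.orthogonalGroup (Fin n) ℝ) :
    EuclideanSpace ℝ (Fin n) ≃ₗᵢ[ℝ] EuclideanSpace ℝ (Fin n) :=
  Unitary.linearIsometryEquiv
    ⟨Matrix.toEuclideanCLM (n := Fin n) (𝕜 := ℝ) g.1, Unitary.map_mem _ g.2⟩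

/-- `g` acts as multiplication of column vectors by the matrix `g`. -/
theorem orthogonalIsometry_apply {n : ℕ} (g : Matrix.orthogonalGroup (Fin n) ℝ)
    (x : EuclideanSpace ℝ (Fin n)) :
    orthogonalIsometry g x = WithLp.toLp 2 (Matrix.mulVec g.1 x.ofLp) := by
  rfl

/-- The action of the orthogonal group on the Grassmannian: `g` sends `V` to `g(V)`. -/
noncomputable def RealGrassmannian.rotate {n k : ℕ} (g : Matrix.orthogonalGroup (Fin n) ℝ)
    (V : RealGrassmannian n k) : RealGrassmannian n k :=
  ⟨V.1.map ((orthogonalIsometry g).toLinearEquiv :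
      EuclideanSpace ℝ (Fin n) →ₗ[ℝ] EuclideanSpace ℝ (Fin n)),
    (LinearEquiv.finrank_map_eq _ _).trans V.2⟩

/-- The standard point of `G(n, k)`: the span of the first `k` standard basis vectors. -/
noncomputable def RealGrassmannian.base {n k : ℕ} (h : k ≤ n) : RealGrassmannian n k :=
  ⟨Submodule.span ℝ (Set.range fun i : Fin k => EuclideanSpace.single (Fin.castLE h i) (1 : ℝ)),
    by
      have hli : LinearIndependent ℝ
          (fun i : Fin k => EuclideanSpace.single (Fin.castLE h i) (1 : ℝ)) :=
        ((EuclideanSpace.orthonormal_single (𝕜 := ℝ) (ι := Fin n)).comp _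
          (Fin.castLE_injective h)).linearIndependent
      simpa using finrank_span_eq_card hli⟩

/-- The natural projection `O(n) → G(n, k)`. -/
noncomputable def RealGrassmannian.proj {n k : ℕ} (h : k ≤ n)
    (g : Matrix.orthogonalGroup (Fin n) ℝ) : RealGrassmannian n k :=
  (RealGrassmannian.base h).rotate g

/-- Haar measure on `G(n, k)`: the image of Haar measure on `O(n)` under the natural
projection. -/
noncomputable def grassmannianHaar {n k : ℕ} (h : k ≤ n) : Measure (RealGrassmannian n k) :=
  (orthogonalHaar n).map (RealGrassmannian.proj h)

theorem RealGrassmannian.continuous_rotate_left {n k : ℕ} (V : RealGrassmannian n k) :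
    Continuous fun g : Matrix.orthogonalGroup (Fin n) ℝ => V.rotate g := by
  rw [continuous_induced_rng]
  have hc : Continuous fun A : Matrix (Fin n) (Fin n) ℝ =>
      Matrix.toEuclideanCLM (n := Fin n) (𝕜 := ℝ) A :=
    LinearMap.continuous_of_finiteDimensional
      (Matrix.toEuclideanCLM (n := Fin n) (𝕜 := ℝ)).toAlgEquiv.toLinearMap
  have key : ((fun V : RealGrassmannian n k => V.1.starProjection) ∘ fun g => V.rotate g) =
      fun g : Matrix.orthogonalGroup (Fin n) ℝ =>
        Matrix.toEuclideanCLM (n := Fin n) (𝕜 := ℝ) g.1 * V.1.starProjection *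
          Matrix.toEuclideanCLM (n := Fin n) (𝕜 := ℝ) (g⁻¹).1 := by
    funext g
    ext1 x
    have hsymm : (orthogonalIsometry g).symm x =
        Matrix.toEuclideanCLM (n := Fin n) (𝕜 := ℝ) (g⁻¹).1 x := by
      rw [LinearIsometryEquiv.symm_apply_eq]
      change x = (Matrix.toEuclideanCLM (n := Fin n) (𝕜 := ℝ) g.1 *
        Matrix.toEuclideanCLM (n := Fin n) (𝕜 := ℝ) (g⁻¹).1) x
      rw [← map_mul, ← Submonoid.coe_mul, mul_inv_cancel, Submonoid.coe_one, map_one]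
      rfl
    refine (Submodule.starProjection_map_apply (orthogonalIsometry g) V.1 x).trans ?_
    rw [hsymm]
    rfl
  rw [key]
  exact ((hc.comp continuous_subtype_val).mul continuous_const).mul
    (hc.comp (continuous_subtype_val.comp continuous_inv))

instance instIsProbabilityMeasureOrthogonalHaar (n : ℕ) :
    IsProbabilityMeasure (orthogonalHaar n) :=
  ⟨Measure.haarMeasure_self⟩

/-- The projection is measurable, so that the image measure has total mass `1`. -/
instance instIsProbabilityMeasureGrassmannianHaar {n k : ℕ} (h : k ≤ n) :
    IsProbabilityMeasure (grassmannianHaar h) :=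
  Measure.isProbabilityMeasure_map
    (RealGrassmannian.continuous_rotate_left (RealGrassmannian.base h)).measurable.aemeasurable

/-- The event that a `k`-dimensional subspace of `ℝⁿ` contains a positive vector. -/
def containsPositiveVector (n k : ℕ) : Set (RealGrassmannian n k) :=
  {V | ∃ t ∈ V.1, IsPositiveVector t}

/-- `p(n, k)`: the probability that a random `k`-dimensional subspace of `ℝⁿ`, distributed by
Haar measure on `G(n, k)`, contains a positive vector. -/
noncomputable def positiveVectorProb {n k : ℕ} (h : k ≤ n) : ℝ :=
  (grassmannianHaar h).real (containsPositiveVector n k)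

/-! Diagonal sign matrices preserve Haar measure on `O(n)`, so `2 ^ n` times the probability is the
expected number of signs `ε` for which `εV` contains a positive vector. Here `V` is the column space
of an `n × k` matrix `B`, the first columns of a random orthogonal matrix. Almost surely all maximal
minors of `B` are nonzero (`ae_hasNonzeroMinors_firstColumns`), and then `εV` contains a positive
vector exactly when `ε` labels an open cell of the arrangement cut out in `ℝᵏ` by the rows of `B`
(`HasNonzeroMinors.mem_signPatterns_iff`). The number of cells of `n` generic central hyperplanes is
a constant, found by deletion and restriction (`ncard_signPatterns`), so the expectation needs no
further computation. -/

/-! ### Counting the cells of a generic central arrangement. -/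

/-- The sign patterns realized on open cells by a family of linear functionals. -/
def signPatterns {n : ℕ} {E : Type*} [AddCommGroup E] [Module ℝ E]
    (l : Fin n → Module.Dual ℝ E) : Set (Fin n → ℤˣ) :=
  {ε | ∃ x, ∀ i, 0 < ((ε i : ℤ) : ℝ) * l i x}

/-- Any at most `k` of the functionals take arbitrary prescribed values. -/
def InGeneralPosition {n : ℕ} {E : Type*} [AddCommGroup E] [Module ℝ E]
    (l : Fin n → Module.Dual ℝ E) (k : ℕ) : Prop :=
  ∀ I : Finset (Fin n), I.card ≤ k → ∀ y : Fin n → ℝ, ∃ x, ∀ i ∈ I, l i x = y i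

/-- The number of cells of a central arrangement of `n` hyperplanes in general position in
dimension `k`. -/
def cellCount : ℕ → ℕ → ℕ
  | 0, _ => 1
  | _ + 1, 0 => 0
  | n + 1, k + 1 => cellCount n (k + 1) + cellCount n k

/-- The factor 2 needs at least one hyperplane: with none there is a single cell. -/
theorem cellCount_succ (n k : ℕ) :
    cellCount (n + 1) k = 2 * ∑ j ∈ Finset.range k, n.choose j := by
  induction n generalizing k with
  | zero =>
    cases k with
    | zero => rfl
    | succ k => simp [cellCount, Finset.sum_range_succ', Nat.choose_eq_zero_of_lt]
  | succ n ih =>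
    cases k with
    | zero => rfl
    | succ k =>
      rw [cellCount, ih, ih, Finset.sum_range_succ' (fun j => (n + 1).choose j),
        Finset.sum_range_succ' (fun j => n.choose j)]
      simp only [Nat.choose_succ_succ, Finset.sum_add_distrib, Nat.choose_zero_right]
      ring

theorem exists_pos_perturbation {n : ℕ} {a : Fin n → ℝ} (b : Fin n → ℝ) (ha : ∀ i, 0 < a i) :
    ∃ δ : ℝ, 0 < δ ∧ ∀ i, 0 < a i + δ * b i := by
  have h : ∀ᶠ δ in nhdsWithin (0 : ℝ) (Set.Ioi 0), ∀ i, 0 < a i + δ * b i := by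
    refine Filter.eventually_all.2 fun i => ?_
    have hc : Continuous fun δ : ℝ => a i + δ * b i := by fun_prop
    refine Filter.Tendsto.eventually_const_lt ?_ (hc.tendsto 0 |>.mono_left nhdsWithin_le_nhds)
    simpa using ha i
  obtain ⟨δ, h1, h2⟩ := (h.and self_mem_nhdsWithin).exists
  exact ⟨δ, h2, h1⟩

theorem ncard_signs_succ {n : ℕ} (S : Set (Fin (n + 1) → ℤˣ)) :
    S.ncard = {ε : Fin n → ℤˣ | (Fin.cons 1 ε : Fin (n + 1) → ℤˣ) ∈ S}.ncard +
      {ε : Fin n → ℤˣ | (Fin.cons (-1) ε : Fin (n + 1) → ℤˣ) ∈ S}.ncard := by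
  set A := {ε : Fin n → ℤˣ | (Fin.cons 1 ε : Fin (n + 1) → ℤˣ) ∈ S}
  set B := {ε : Fin n → ℤˣ | (Fin.cons (-1) ε : Fin (n + 1) → ℤˣ) ∈ S}
  have hS : S = (fun ε : Fin n → ℤˣ => (Fin.cons 1 ε : Fin (n + 1) → ℤˣ)) '' A ∪
      (fun ε : Fin n → ℤˣ => (Fin.cons (-1) ε : Fin (n + 1) → ℤˣ)) '' B := by
    ext ε
    constructor
    · intro h
      rcases Int.units_eq_one_or (ε 0) with h0 | h0
      · exact Or.inl ⟨Fin.tail ε, by simpa [A, ← h0] using h, by simp [← h0]⟩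
      · exact Or.inr ⟨Fin.tail ε, by simpa [B, ← h0] using h, by simp [← h0]⟩
    · rintro (⟨η, h, rfl⟩ | ⟨η, h, rfl⟩) <;> exact h
  have hd : Disjoint ((fun ε : Fin n → ℤˣ => (Fin.cons 1 ε : Fin (n + 1) → ℤˣ)) '' A)
      ((fun ε : Fin n → ℤˣ => (Fin.cons (-1) ε : Fin (n + 1) → ℤˣ)) '' B) := by
    rw [Set.disjoint_left]
    rintro _ ⟨η, -, rfl⟩ ⟨θ, -, h⟩
    have := congrFun h 0
    simp at this
  conv_lhs => rw [hS]
  rw [Set.ncard_union_eq hd (Set.toFinite _) (Set.toFinite _),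
    Set.ncard_image_of_injective _ (Fin.cons_right_injective (α := fun _ => ℤˣ) 1),
    Set.ncard_image_of_injective _ (Fin.cons_right_injective (α := fun _ => ℤˣ) (-1))]

theorem cons_mem_signPatterns {n : ℕ} {E : Type*} [AddCommGroup E] [Module ℝ E]
    (l : Fin (n + 1) → Module.Dual ℝ E) (u : ℤˣ) (ε : Fin n → ℤˣ) :
    (Fin.cons u ε : Fin (n + 1) → ℤˣ) ∈ signPatterns l ↔
      ∃ x, 0 < ((u : ℤ) : ℝ) * l 0 x ∧ ∀ i : Fin n, 0 < ((ε i : ℤ) : ℝ) * l i.succ x := by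
  simp [signPatterns, Fin.forall_fin_succ]

theorem exists_signed_perturbation {n : ℕ} {E : Type*} [AddCommGroup E] [Module ℝ E]
    {l : Fin (n + 1) → Module.Dual ℝ E} {v x : E} {ε : Fin n → ℤˣ} (u : ℤˣ)
    (hv : l 0 v = ((u : ℤ) : ℝ)) (h0 : l 0 x = 0)
    (hx : ∀ i : Fin n, 0 < ((ε i : ℤ) : ℝ) * l i.succ x) :
    (Fin.cons u ε : Fin (n + 1) → ℤˣ) ∈ signPatterns l := by
  obtain ⟨δ, hδ, h⟩ := exists_pos_perturbation (fun i => ((ε i : ℤ) : ℝ) * l i.succ v) hx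
  refine (cons_mem_signPatterns l u ε).2 ⟨x + δ • v, ?_, fun i => ?_⟩
  · rcases Int.units_eq_one_or u with rfl | rfl <;> simpa [h0, hv] using hδ
  · have := h i
    simp only [map_add, map_smul, smul_eq_mul]
    linarith

/-- Deletion and restriction of the first functional. -/
theorem ncard_signPatterns_succ {n : ℕ} {E : Type*} [AddCommGroup E] [Module ℝ E]
    (l : Fin (n + 1) → Module.Dual ℝ E) (h0 : ∃ v, l 0 v = 1) :
    (signPatterns l).ncard = (signPatterns fun i : Fin n => l i.succ).ncard +
      (signPatterns fun i : Fin n => (l i.succ).domRestrict (LinearMap.ker (l 0))).ncard := by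
  obtain ⟨v, hv⟩ := h0
  have hv' : ∀ u : ℤˣ, l 0 (((u : ℤ) : ℝ) • v) = ((u : ℤ) : ℝ) := fun u => by simp [hv]
  -- A pattern of the remaining functionals extends by some sign of `l 0` iff it is realized at all
  -- (union), and by both signs iff it is realized on `ker (l 0)` (intersection).
  rw [ncard_signs_succ, ← Set.ncard_union_add_ncard_inter _ _ (Set.toFinite _) (Set.toFinite _)]
  congr 2
  · ext ε
    constructor
    · rintro (h | h)
      · obtain ⟨x, -, hx⟩ := (cons_mem_signPatterns l _ ε).1 h
        exact ⟨x, hx⟩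
      · obtain ⟨x, -, hx⟩ := (cons_mem_signPatterns l _ ε).1 h
        exact ⟨x, hx⟩
    · rintro ⟨x, hx⟩
      rcases lt_trichotomy (l 0 x) 0 with h | h | h
      · exact Or.inr ((cons_mem_signPatterns l _ ε).2 ⟨x, by simpa using h, hx⟩)
      · exact Or.inl (exists_signed_perturbation 1 (hv' 1) h hx)
      · exact Or.inl ((cons_mem_signPatterns l _ ε).2 ⟨x, by simpa using h, hx⟩)
  · ext ε
    constructor
    · rintro ⟨h1, h2⟩
      obtain ⟨x, hx0, hx⟩ := (cons_mem_signPatterns l _ ε).1 h1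
      obtain ⟨y, hy0, hy⟩ := (cons_mem_signPatterns l _ ε).1 h2
      simp only [Units.val_one, Int.cast_one, one_mul] at hx0
      simp only [Units.val_neg, Units.val_one, Int.cast_neg, Int.cast_one, neg_mul, one_mul] at hy0
      -- Since `l 0 y < 0 < l 0 x`, this is a positive combination of `x` and `y`; it lies on the
      -- hyperplane and keeps their common signs.
      refine ⟨⟨(-l 0 y) • x + l 0 x • y, ?_⟩, fun i => ?_⟩
      · simp only [LinearMap.mem_ker, map_add, map_smul, smul_eq_mul]
        ring
      · simp only [LinearMap.domRestrict_apply, map_add, map_smul, smul_eq_mul]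
        have := add_pos (mul_pos hy0 (hx i)) (mul_pos hx0 (hy i))
        linarith
    · rintro ⟨⟨x, hx0⟩, hx⟩
      exact ⟨exists_signed_perturbation 1 (hv' 1) hx0 hx,
        exists_signed_perturbation (-1) (hv' (-1)) hx0 hx⟩

theorem InGeneralPosition.tail {n k : ℕ} {E : Type*} [AddCommGroup E] [Module ℝ E]
    {l : Fin (n + 1) → Module.Dual ℝ E} (h : InGeneralPosition l k) :
    InGeneralPosition (fun i : Fin n => l i.succ) k := by
  intro I hI y
  obtain ⟨x, hx⟩ := h (I.map (Fin.succEmb n)) (by simpa using hI) (Fin.cons 0 y)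
  exact ⟨x, fun i hi => by simpa using hx i.succ (by simpa using hi)⟩

/-- Prescribing the value 0 for `l 0` uses up one of the `k + 1` available functionals. -/
theorem InGeneralPosition.restrict {n k : ℕ} {E : Type*} [AddCommGroup E] [Module ℝ E]
    {l : Fin (n + 1) → Module.Dual ℝ E} (h : InGeneralPosition l (k + 1)) :
    InGeneralPosition (fun i : Fin n => (l i.succ).domRestrict (LinearMap.ker (l 0))) k := by
  intro I hI y
  obtain ⟨x, hx⟩ := h (insert 0 (I.map (Fin.succEmb n)))
    ((Finset.card_insert_le _ _).trans (by simpa using hI)) (Fin.cons 0 y)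
  refine ⟨⟨x, ?_⟩, fun i hi => ?_⟩
  · simpa using hx 0 (by simp)
  · simpa using hx i.succ (by simp [hi])

theorem ncard_signPatterns {n k : ℕ} {E : Type*} [AddCommGroup E] [Module ℝ E]
    [Module.Finite ℝ E] (hE : Module.finrank ℝ E = k) {l : Fin n → Module.Dual ℝ E}
    (hl : InGeneralPosition l k) : (signPatterns l).ncard = cellCount n k := by
  induction n generalizing k E with
  | zero =>
    have : signPatterns l = Set.univ := Set.eq_univ_of_forall fun ε => ⟨0, fun i => i.elim0⟩
    rw [this, Set.ncard_univ, cellCount]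
    simp
  | succ n ih =>
    cases k with
    | zero =>
      have := Module.finrank_zero_iff.1 hE
      have : signPatterns l = ∅ := by
        refine Set.eq_empty_of_forall_notMem ?_
        rintro ε ⟨x, hx⟩
        have := hx 0
        simp [Subsingleton.elim x 0] at this
      rw [this, Set.ncard_empty, cellCount]
    | succ k =>
      obtain ⟨v, hv⟩ := hl {0} (by simp) 1
      have hv : l 0 v = 1 := by simpa using hv
      have h0 : l 0 ≠ 0 := fun h => by simp [h] at hv
      rw [ncard_signPatterns_succ l ⟨v, hv⟩, cellCount, ih hE hl.tail, ih ?_ hl.restrict]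
      have := Module.Dual.finrank_ker_add_one_of_ne_zero h0
      omega

/-! ### Arrangements given by the rows of a generic matrix. -/

/-- All maximal minors of the matrix are nonzero. -/
def HasNonzeroMinors {n k : ℕ} (B : Matrix (Fin n) (Fin k) ℝ) : Prop :=
  ∀ r : Fin k → Fin n, Function.Injective r → (B.submatrix r id).det ≠ 0

/-- The rows of a matrix, as linear functionals. -/
noncomputable def rowFunctional {n k : ℕ} (B : Matrix (Fin n) (Fin k) ℝ) (i : Fin n) :
    Module.Dual ℝ (Fin k → ℝ) :=
  LinearMap.proj i ∘ₗ B.mulVecLin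

theorem rowFunctional_apply {n k : ℕ} (B : Matrix (Fin n) (Fin k) ℝ) (i : Fin n)
    (y : Fin k → ℝ) : rowFunctional B i y = B.mulVec y i := rfl

theorem HasNonzeroMinors.inGeneralPosition {n k : ℕ} (hkn : k ≤ n)
    {B : Matrix (Fin n) (Fin k) ℝ} (hB : HasNonzeroMinors B) :
    InGeneralPosition (rowFunctional B) k := by
  intro I hI y
  obtain ⟨J, hIJ, hJ⟩ := Finset.exists_superset_card_eq hI (by simpa using hkn)
  have hdet := hB (J.orderEmbOfFin hJ) (J.orderEmbOfFin hJ).injective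
  refine ⟨(B.submatrix (J.orderEmbOfFin hJ) id)⁻¹.mulVec fun a => y (J.orderEmbOfFin hJ a),
    fun i hi => ?_⟩
  obtain ⟨a, rfl⟩ : i ∈ Set.range (J.orderEmbOfFin hJ) := by
    rw [Finset.range_orderEmbOfFin]
    exact hIJ hi
  have h : (B.submatrix (J.orderEmbOfFin hJ) id).mulVec
      ((B.submatrix (J.orderEmbOfFin hJ) id)⁻¹.mulVec fun a => y (J.orderEmbOfFin hJ a)) =
      fun a => y (J.orderEmbOfFin hJ a) := by
    rw [Matrix.mulVec_mulVec, Matrix.mul_nonsing_inv _ (isUnit_iff_ne_zero.2 hdet),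
      Matrix.one_mulVec]
  exact congrFun h a

/-- Already `k` vanishing coordinates would force `y = 0`. The weaker bound is what general position
requires. -/
theorem HasNonzeroMinors.card_zeros_le {n k : ℕ} {B : Matrix (Fin n) (Fin k) ℝ}
    (hB : HasNonzeroMinors B) {y : Fin k → ℝ} (hy : y ≠ 0) :
    (Finset.univ.filter fun i => B.mulVec y i = 0).card ≤ k := by
  by_contra! h
  obtain ⟨J, hJs, hJ⟩ := Finset.exists_subset_card_eq h.le
  refine hy (Matrix.eq_zero_of_mulVec_eq_zero
    (hB (J.orderEmbOfFin hJ) (J.orderEmbOfFin hJ).injective) ?_)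
  funext a
  have := hJs (J.orderEmbOfFin_mem hJ a)
  exact (Finset.mem_filter.1 this).2

/-- For a matrix in general position, weak and strict sign conditions are equivalent. -/
theorem HasNonzeroMinors.mem_signPatterns_iff {n k : ℕ} (hkn : k ≤ n)
    {B : Matrix (Fin n) (Fin k) ℝ} (hB : HasNonzeroMinors B) (hk : 1 ≤ k) (ε : Fin n → ℤˣ) :
    ε ∈ signPatterns (rowFunctional B) ↔
      ∃ y, (∀ i, 0 ≤ ((ε i : ℤ) : ℝ) * B.mulVec y i) ∧
        ∃ i, 0 < ((ε i : ℤ) : ℝ) * B.mulVec y i := by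
  constructor
  · rintro ⟨y, hy⟩
    exact ⟨y, fun i => (hy i).le, ⟨0, by omega⟩, hy _⟩
  · rintro ⟨y, hy, j, hj⟩
    have hy0 : y ≠ 0 := by
      rintro rfl
      simp at hj
    -- Moving slightly along `v` gives the vanishing coordinates of `B y` the signs `ε` without
    -- changing the signs of the others.
    obtain ⟨v, hv⟩ := hB.inGeneralPosition hkn _ (hB.card_zeros_le hy0)
      fun i => ((ε i : ℤ) : ℝ)
    have hsq : ∀ i, ((ε i : ℤ) : ℝ) * ((ε i : ℤ) : ℝ) = 1 := fun i => by
      rcases Int.units_eq_one_or (ε i) with h | h <;> simp [h]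
    have hne : ∀ i, ((ε i : ℤ) : ℝ) ≠ 0 := fun i h => by simpa [h] using hsq i
    obtain ⟨δ, hδ, h⟩ := exists_pos_perturbation
      (a := fun i => if B.mulVec y i = 0 then 1 else ((ε i : ℤ) : ℝ) * B.mulVec y i)
      (fun i => ((ε i : ℤ) : ℝ) * B.mulVec v i) fun i => by
        split_ifs with h
        · exact one_pos
        · exact lt_of_le_of_ne (hy i) (mul_ne_zero (hne i) h).symm
    refine ⟨y + δ • v, fun i => ?_⟩
    have hi := h i
    rw [rowFunctional_apply, Matrix.mulVec_add, Matrix.mulVec_smul]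
    simp only [Pi.add_apply, Pi.smul_apply, smul_eq_mul]
    split_ifs at hi with h0
    · have := hv i (by simpa using h0)
      rw [rowFunctional_apply] at this
      rw [this, h0, zero_add, mul_left_comm, hsq, mul_one]
      exact hδ
    · linarith

/-! ### The random subspace as a column space, and closedness of the event. -/

/-- The first `k` columns of an orthogonal matrix. -/
def firstColumns {n k : ℕ} (h : k ≤ n) (g : Matrix.orthogonalGroup (Fin n) ℝ) :
    Matrix (Fin n) (Fin k) ℝ :=
  g.1.submatrix id (Fin.castLE h)

theorem mem_proj_iff {n k : ℕ} (h : k ≤ n) (g : Matrix.orthogonalGroup (Fin n) ℝ)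
    (t : EuclideanSpace ℝ (Fin n)) :
    t ∈ (RealGrassmannian.proj h g).1 ↔ ∃ y, (firstColumns h g).mulVec y = t.ofLp := by
  change t ∈ Submodule.map _ (Submodule.span ℝ (Set.range _)) ↔ _
  rw [Submodule.map_span, ← Set.range_comp, Submodule.mem_span_range_iff_exists_fun]
  refine exists_congr fun y => ?_
  rw [← (WithLp.ofLp_injective 2).eq_iff]
  refine Eq.congr_left ?_
  funext i
  simp [orthogonalIsometry_apply, firstColumns, Matrix.mulVec, dotProduct, mul_comm]

theorem proj_mem_containsPositiveVector_iff {n k : ℕ} (h : k ≤ n)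
    (g : Matrix.orthogonalGroup (Fin n) ℝ) :
    RealGrassmannian.proj h g ∈ containsPositiveVector n k ↔
      ∃ y, (∀ i, 0 ≤ (firstColumns h g).mulVec y i) ∧
        ∃ i, 0 < (firstColumns h g).mulVec y i := by
  constructor
  · rintro ⟨t, ht, hp⟩
    obtain ⟨y, hy⟩ := (mem_proj_iff h g t).1 ht
    exact ⟨y, hy ▸ hp⟩
  · rintro ⟨y, hy⟩
    exact ⟨WithLp.toLp 2 ((firstColumns h g).mulVec y), (mem_proj_iff h g _).2 ⟨y, rfl⟩, hy⟩

/-- Positive vectors can be rescaled into the standard simplex. The incidence relation `t ∈ V` is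
closed, and projecting along a compact factor is a closed map. -/
theorem isClosed_containsPositiveVector (n k : ℕ) : IsClosed (containsPositiveVector n k) := by
  have hc : IsClosed {p : RealGrassmannian n k × stdSimplex ℝ (Fin n) |
      p.1.1.starProjection (WithLp.toLp 2 p.2.1) = WithLp.toLp 2 p.2.1} := by
    have h1 : Continuous fun p : RealGrassmannian n k × stdSimplex ℝ (Fin n) =>
        (p.1.1.starProjection : EuclideanSpace ℝ (Fin n) →L[ℝ] EuclideanSpace ℝ (Fin n)) :=
      Continuous.comp (g := fun V : RealGrassmannian n k => V.1.starProjection)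
        continuous_induced_dom continuous_fst
    have h2 : Continuous fun p : RealGrassmannian n k × stdSimplex ℝ (Fin n) =>
        (WithLp.toLp 2 p.2.1 : EuclideanSpace ℝ (Fin n)) :=
      (PiLp.continuous_toLp 2 _).comp (continuous_subtype_val.comp continuous_snd)
    exact isClosed_eq (h1.clm_apply h2) h2
  convert isClosedMap_fst_of_compactSpace _ hc using 1
  ext V
  simp only [Set.mem_image, Set.mem_ofPred_eq, Prod.exists, exists_and_right, exists_eq_right,
    Submodule.starProjection_eq_self_iff]
  constructor
  · rintro ⟨t, ht, h0, i, hi⟩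
    have hs : 0 < ∑ j, t j := Finset.sum_pos' (fun j _ => h0 j) ⟨i, Finset.mem_univ i, hi⟩
    refine ⟨⟨((∑ j, t j)⁻¹ • t).ofLp, fun j => ?_, ?_⟩, V.1.smul_mem _ ht⟩
    · exact mul_nonneg (inv_nonneg.2 hs.le) (h0 j)
    · simp only [PiLp.smul_apply, smul_eq_mul, ← Finset.mul_sum]
      exact inv_mul_cancel₀ hs.ne'
  · rintro ⟨⟨t, h0, h1⟩, ht⟩
    refine ⟨_, ht, h0, ?_⟩
    by_contra! hle
    have : ∑ i, t i ≤ 0 := Finset.sum_nonpos fun i _ => hle i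
    linarith

/-! ### Almost sure nonvanishing of the minors. -/

instance instSecondCountableTopologyOrthogonalGroup (n : ℕ) :
    SecondCountableTopology (Matrix.orthogonalGroup (Fin n) ℝ) :=
  haveI : SecondCountableTopology (Matrix (Fin n) (Fin n) ℝ) :=
    inferInstanceAs (SecondCountableTopology (Fin n → Fin n → ℝ))
  inferInstanceAs (SecondCountableTopology
    ((Matrix.orthogonalGroup (Fin n) ℝ : Set (Matrix (Fin n) (Fin n) ℝ))))

instance instIsHaarMeasureOrthogonalHaar (n : ℕ) : (orthogonalHaar n).IsHaarMeasure :=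
  Measure.isHaarMeasure_haarMeasure _

theorem continuous_firstColumns {n k : ℕ} (h : k ≤ n) : Continuous (firstColumns h) :=
  continuous_subtype_val.matrix_submatrix _ _

theorem firstColumns_mul {n k : ℕ} (h : k ≤ n) (a g : Matrix.orthogonalGroup (Fin n) ℝ) :
    firstColumns h (a * g) = a.1 * firstColumns h g := by
  ext i j
  simp [firstColumns, Matrix.mul_apply]

theorem transpose_firstColumns_mul_self {n k : ℕ} (h : k ≤ n)
    (g : Matrix.orthogonalGroup (Fin n) ℝ) :
    (firstColumns h g).transpose * firstColumns h g = 1 := by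
  have hg : g.1.transpose * g.1 = 1 := (Matrix.mem_orthogonalGroup_iff' (Fin n) ℝ).1 g.2
  ext i j
  have := congrFun (congrFun hg (Fin.castLE h i)) (Fin.castLE h j)
  simpa [firstColumns, Matrix.mul_apply, Matrix.one_apply, Fin.ext_iff] using this

/-- As a function of `s`, the determinant is the characteristic polynomial of `-A`, which is monic
and so has finitely many roots. -/
theorem ae_det_add_smul_one_ne_zero {k : ℕ} (A : Matrix (Fin k) (Fin k) ℝ) :
    ∀ᵐ s : ℝ, (A + s • (1 : Matrix (Fin k) (Fin k) ℝ)).det ≠ 0 := by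
  have hfin : {s : ℝ | (-A).charpoly.IsRoot s}.Finite :=
    Polynomial.finite_setOfPred_isRoot (-A).charpoly_monic.ne_zero
  refine measure_mono_null (fun s hs => ?_) (hfin.measure_zero _)
  simp only [ne_eq, Set.mem_compl_iff, Set.mem_ofPred_eq, not_not] at hs ⊢
  rw [Polynomial.IsRoot, Matrix.eval_charpoly, ← hs]
  congr 1
  rw [sub_neg_eq_add, add_comm]
  congr 1
  ext i j
  simp [Matrix.scalar_apply, Matrix.diagonal_apply, Matrix.one_apply]

/-- Along any line in the direction `C`, the product with `B` moves by multiples of `C * B = 1`, so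
almost every point of the line is good. -/
theorem ae_det_mul_ne_zero {n k : ℕ} {B : Matrix (Fin n) (Fin k) ℝ}
    {C : Matrix (Fin k) (Fin n) ℝ} (hCB : C * B = 1) :
    ∀ᵐ M : Fin k → Fin n → ℝ, ((Matrix.of M) * B).det ≠ 0 := by
  have hc : Continuous fun M : Fin k → Fin n → ℝ => ((Matrix.of M) * B).det :=
    (Continuous.matrix_mul (continuous_id : Continuous fun M : Fin k → Fin n → ℝ => M)
      continuous_const).matrix_det
  have hm : MeasurableSet {M : Fin k → Fin n → ℝ | ((Matrix.of M) * B).det ≠ 0} :=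
    (isOpen_ne_fun hc continuous_const).measurableSet
  refine ae_mem_of_ae_add_linearMap_mem
    (LinearMap.toSpanSingleton ℝ (Fin k → Fin n → ℝ) (Matrix.of.symm C)) volume volume hm
    fun M => ?_
  filter_upwards [ae_det_add_smul_one_ne_zero (Matrix.of M * B)] with s hs
  rw [← hCB, ← Matrix.smul_mul, ← Matrix.add_mul] at hs
  exact hs

/-- The rows of a matrix with at most `n` rows are combinations of prescribed rows of an
orthogonal matrix. -/
theorem exists_eq_mul_submatrix_orthogonal {n k : ℕ} (h : k ≤ n) (M : Matrix (Fin k) (Fin n) ℝ)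
    {r : Fin k → Fin n} (hr : Function.Injective r) :
    ∃ (R : Matrix (Fin k) (Fin k) ℝ) (a : Matrix.orthogonalGroup (Fin n) ℝ),
      M = R * a.1.submatrix r id := by
  -- Gram–Schmidt applied to the rows of `M`, padded by zeros, expresses them in the first `k` basis
  -- vectors; `σ` then places these in the rows `r`.
  let f : Fin n → EuclideanSpace ℝ (Fin n) := fun i =>
    if hi : i.1 < k then WithLp.toLp 2 (M ⟨i, hi⟩) else 0
  let b := InnerProductSpace.gramSchmidtOrthonormalBasis
    (𝕜 := ℝ) (E := EuclideanSpace ℝ (Fin n)) (ι := Fin n) (by simp) f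
  obtain ⟨σ, hσ⟩ : ∃ σ : Equiv.Perm (Fin n), ∀ i : Fin k, σ (Fin.castLE h i) = r i := by
    obtain ⟨σ, hσ⟩ := Equiv.Perm.exists_extending_pair (Fin.castLE h) r (Fin.castLE_injective h) hr
    exact ⟨σ, hσ⟩
  let a : Matrix (Fin n) (Fin n) ℝ := Matrix.of fun i j => b (σ.symm i) j
  have ha : a ∈ Matrix.orthogonalGroup (Fin n) ℝ := by
    rw [Matrix.mem_orthogonalGroup_iff]
    ext i j
    have := orthonormal_iff_ite.1 b.orthonormal (σ.symm j) (σ.symm i)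
    simp only [EuclideanSpace.inner_eq_star_dotProduct, dotProduct] at this
    simpa [a, Matrix.mul_apply, Matrix.one_apply, eq_comm] using this
  refine ⟨Matrix.of fun c d => inner ℝ (b (Fin.castLE h d)) (WithLp.toLp 2 (M c)), ⟨a, ha⟩, ?_⟩
  ext c j
  have hf : WithLp.toLp 2 (M c) = f (Fin.castLE h c) := by simp [f]
  have hsum := congrArg (fun v : EuclideanSpace ℝ (Fin n) => v j) (b.sum_repr' (WithLp.toLp 2 (M c)))
  have hz : ∀ i ∉ Set.range (Fin.castLE h), inner ℝ (b i) (WithLp.toLp 2 (M c)) = 0 := by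
    intro i hi
    rw [hf]
    refine InnerProductSpace.gramSchmidtOrthonormalBasis_inv_triangular _ _ ?_
    by_contra! hle
    exact hi ⟨⟨i, lt_of_le_of_lt hle c.2⟩, rfl⟩
  simp only [WithLp.ofLp_sum, Finset.sum_apply, PiLp.smul_apply, smul_eq_mul] at hsum
  rw [← hsum, Matrix.mul_apply]
  symm
  refine Fintype.sum_of_injective (Fin.castLE h) (Fin.castLE_injective h) _ _ (fun i hi => ?_)
    fun i => ?_
  · rw [hz i hi, zero_mul]
  · simp [a, ← hσ]

/-- By Fubini, some fixed `M` has `det (M * B) ≠ 0` for almost every `g`. Writing `M` as `R` times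
the rows `r` of an orthogonal `a` makes the minor `r` of `a * g` nonzero almost surely, and left
invariance removes `a`. -/
theorem ae_det_submatrix_firstColumns_ne_zero {n k : ℕ} (h : k ≤ n)
    {r : Fin k → Fin n} (hr : Function.Injective r) :
    ∀ᵐ g ∂orthogonalHaar n, ((firstColumns h g).submatrix r id).det ≠ 0 := by
  have hc : Continuous fun p : Matrix.orthogonalGroup (Fin n) ℝ × (Fin k → Fin n → ℝ) =>
      ((Matrix.of p.2) * firstColumns h p.1).det :=
    (Continuous.matrix_mul
      (continuous_snd : Continuous fun p : Matrix.orthogonalGroup (Fin n) ℝ ×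
        (Fin k → Fin n → ℝ) => p.2)
      ((continuous_firstColumns h).comp continuous_fst)).matrix_det
  have hae : ∀ᵐ M : Fin k → Fin n → ℝ, ∀ᵐ g ∂orthogonalHaar n,
      ((Matrix.of M) * firstColumns h g).det ≠ 0 := by
    rw [← Measure.ae_ae_comm (μ := orthogonalHaar n)
      (p := fun g (M : Fin k → Fin n → ℝ) => ((Matrix.of M) * firstColumns h g).det ≠ 0)
      (isOpen_ne_fun hc continuous_const).measurableSet]
    exact Filter.Eventually.of_forall fun g =>
      ae_det_mul_ne_zero (transpose_firstColumns_mul_self h g)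
  obtain ⟨M, hM⟩ := hae.exists
  obtain ⟨R, a, hRa⟩ := exists_eq_mul_submatrix_orthogonal h (Matrix.of M) hr
  have ha : ∀ᵐ g ∂orthogonalHaar n, ((firstColumns h (a * g)).submatrix r id).det ≠ 0 := by
    filter_upwards [hM] with g hg h0
    refine hg ?_
    have : (Matrix.of M) * firstColumns h g = R * (firstColumns h (a * g)).submatrix r id := by
      rw [hRa, Matrix.mul_assoc, firstColumns_mul]
      rfl
    rw [this, Matrix.det_mul, h0, mul_zero]
  have := (measurePreserving_mul_left (orthogonalHaar n) a⁻¹).quasiMeasurePreserving.ae ha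
  simpa using this

theorem ae_hasNonzeroMinors_firstColumns {n k : ℕ} (h : k ≤ n) :
    ∀ᵐ g ∂orthogonalHaar n, HasNonzeroMinors (firstColumns h g) := by
  have : ∀ᵐ g ∂orthogonalHaar n, ∀ r : {r : Fin k → Fin n // Function.Injective r},
      ((firstColumns h g).submatrix r.1 id).det ≠ 0 :=
    ae_all_iff.2 fun r => ae_det_submatrix_firstColumns_ne_zero h r.2
  filter_upwards [this] with g hg r hr using hg ⟨r, hr⟩

/-! ### Averaging over sign changes. -/

/-- The diagonal orthogonal matrix with prescribed signs. -/
def signMatrix {n : ℕ} (ε : Fin n → ℤˣ) : Matrix.orthogonalGroup (Fin n) ℝ :=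
  ⟨Matrix.diagonal fun i => ((ε i : ℤ) : ℝ), by
    rw [Matrix.mem_orthogonalGroup_iff, Matrix.diagonal_transpose, Matrix.diagonal_mul_diagonal,
      ← Matrix.diagonal_one]
    congr 1
    funext i
    rcases Int.units_eq_one_or (ε i) with h | h <;> simp [h]⟩

theorem firstColumns_signMatrix_mul_mulVec {n k : ℕ} (h : k ≤ n) (ε : Fin n → ℤˣ)
    (g : Matrix.orthogonalGroup (Fin n) ℝ) (y : Fin k → ℝ) (i : Fin n) :
    (firstColumns h (signMatrix ε * g)).mulVec y i =
      ((ε i : ℤ) : ℝ) * (firstColumns h g).mulVec y i := by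
  rw [firstColumns_mul, ← Matrix.mulVec_mulVec, signMatrix, Matrix.mulVec_diagonal]

/-- Almost surely, the number of orthants whose reflected copy of the random subspace contains a
positive vector is the number of cells of a generic arrangement. -/
theorem ae_sum_indicator_eq_cellCount {n k : ℕ} (hk : 1 ≤ k) (h : k ≤ n) :
    ∀ᵐ g ∂orthogonalHaar n,
      ∑ ε : Fin n → ℤˣ, ((signMatrix ε * ·) ⁻¹'
        (RealGrassmannian.proj h ⁻¹' containsPositiveVector n k)).indicator
          (fun _ => (1 : ENNReal)) g = cellCount n k := by
  classical
  filter_upwards [ae_hasNonzeroMinors_firstColumns h] with g hg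
  have key : ∀ ε : Fin n → ℤˣ, g ∈ (signMatrix ε * ·) ⁻¹'
      (RealGrassmannian.proj h ⁻¹' containsPositiveVector n k) ↔
        ε ∈ signPatterns (rowFunctional (firstColumns h g)) := fun ε => by
    rw [hg.mem_signPatterns_iff h hk, Set.mem_preimage, Set.mem_preimage,
      proj_mem_containsPositiveVector_iff]
    simp only [firstColumns_signMatrix_mul_mulVec]
  simp only [Set.indicator_apply, key]
  rw [Finset.sum_boole, ← ncard_signPatterns (by simp) (hg.inGeneralPosition h),
    Set.ncard_eq_toFinset_card']
  congr 2
  ext ε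
  simp

/-- Integrate the almost sure count: by left invariance each of the `2 ^ n` indicators contributes
the same measure. -/
theorem two_pow_mul_measure_eq_cellCount {n k : ℕ} (hk : 1 ≤ k) (h : k ≤ n) :
    2 ^ n * grassmannianHaar h (containsPositiveVector n k) = cellCount n k := by
  have hproj : Measurable (RealGrassmannian.proj (k := k) h) :=
    (RealGrassmannian.continuous_rotate_left (RealGrassmannian.base h)).measurable
  have hP : MeasurableSet (RealGrassmannian.proj h ⁻¹' containsPositiveVector n k) :=
    hproj (isClosed_containsPositiveVector n k).measurableSet
  have hint := lintegral_congr_ae (ae_sum_indicator_eq_cellCount hk h)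
  rw [lintegral_const, measure_univ, mul_one, lintegral_finsetSum] at hint
  · rw [← hint, grassmannianHaar, Measure.map_apply hproj
      (isClosed_containsPositiveVector n k).measurableSet]
    have : ∀ ε : Fin n → ℤˣ, ∫⁻ g, ((signMatrix ε * ·) ⁻¹'
        (RealGrassmannian.proj h ⁻¹' containsPositiveVector n k)).indicator
          (fun _ => (1 : ENNReal)) g ∂orthogonalHaar n =
        orthogonalHaar n (RealGrassmannian.proj h ⁻¹' containsPositiveVector n k) := fun ε => by
      rw [lintegral_indicator_const (measurable_const_mul _ hP), one_mul, measure_preimage_mul]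
    simp [this]
  · exact fun ε _ => measurable_const.indicator (measurable_const_mul _ hP)

theorem mainTheorem1 (n k : ℕ) (hk : 1 ≤ k) (hkn : k ≤ n) :
    MeasurableSet (containsPositiveVector n k) ∧
      positiveVectorProb hkn =
        1 / 2 ^ (n - 1) * ∑ j ∈ Finset.range k, ((n - 1).choose j : ℝ) := by
  refine ⟨(isClosed_containsPositiveVector n k).measurableSet, ?_⟩
  obtain ⟨m, rfl⟩ : ∃ m, n = m + 1 := ⟨n - 1, by omega⟩
  have h := congrArg ENNReal.toReal (two_pow_mul_measure_eq_cellCount hk hkn)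
  -- The factor 2 in the cell count turns `2 ^ n` into `2 ^ (n - 1)`.
  rw [cellCount_succ] at h
  simp only [ENNReal.toReal_mul, ENNReal.toReal_pow, ENNReal.toReal_ofNat,
    ENNReal.toReal_natCast] at h
  push_cast at h
  rw [positiveVectorProb, measureReal_def, Nat.add_sub_cancel, one_div, eq_inv_mul_iff_mul_eq₀
    (by positivity)]
  rw [pow_succ] at h
  linarith
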